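/- Let $(R,\mathfrak m)$ be a complete Noetherian local ring with coefficient field $k$: $R$ is a $k$-algebra and $k\to R/\mathfrak m$ is an isomorphism. Let $E$ be an injective hull of $R/\mathfrak m$ as an $R$-module, and let $\sigma\colon E\to k$ be a $k$-linear projection of $E$ onto its socle $(0:_E\mathfrak m)\cong k$. For an $R$-module $M$ write $D(M)=\operatorname{Hom}_R(M,E)$. Let $\mathcal D=\mathcal D(R,k)\subset\operatorname{End}_k(R)$ be the ring of $k$-linear differential operators on $R$ (operators of order $0$ are multiplications by elements of $R$; $d$ has order $\le j$ if $[d,r]$ has order $\le j-1$ for all $r\in R$). A $k$-linear map $\delta\colon M\to N$ of $R$-modules is called $\Sigma$-continuous if for every finitely generated $R$-submodule $L\subset M$ the $R$-submodule $\langle\delta(L)\rangle\subset N$ generated by $\delta(L)$ is finitely generated and for every $t$ there is an $s$ with $\delta(\mathfrak m^sL)\subset\mathfrak m^t\langle\delta(L)\rangle$. Let $D^\Sigma(M)$ be the set of $\Sigma$-continuous $k$-linear maps $M\to k$ (where $k=R/\mathfrak m$ as an $R$-module). For every $R$-module $M$, the map $\Phi_M\colon D(M)\to D^\Sigma(M)$,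 $\varphi\mapsto\sigma\circ\varphi$, is a well-defined bijection, and the Matlis dual of a $\Sigma$-continuous map $\delta\colon M\to N$ is $\delta^*=\Phi_M^{-1}\circ\delta^\vee\circ\Phi_N\colon D(N)\to D(M)$, where $\delta^\vee(\lambda)=\lambda\circ\delta$. (1) Let $M$ be a left (respectively right) $\mathcal D$-module. Every $\delta\in\mathcal D$ acts on $M$ by a $\Sigma$-continuous map $\delta_M\colon M\to M$, and $\varphi\cdot\delta=\delta_M^*(\varphi)$ (respectively $\delta\cdot\varphi=\delta_M^*(\varphi)$) defines on $D(M)$ a structure of right (respectively left) $\mathcal D$-module which extends the usual $R$-module structure of $D(M)$. (2) Let $f\colon M\to N$ be a homomorphism of left (respectively right) $\mathcal D$-modules. Then $f$ is $\Sigma$-continuous, its Matlis dual $f^*\colon D(N)\to D(M)$ is $\varphi\mapsto\varphi\circ f$, and $f^*$ is a homomorphism of right (respectively left) $\mathcal D$-modules for the structures in (1). Hence $M\mapsto D(M)$, $f\mapsto f^*$ defines contravariant functors from left $\mathcal D$-modules to right $\mathcal D$-modules and from right $\mathcal D$-modules to left $\mathcal D$-modules. -/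

import Mathlib

open CategoryTheory IsLocalRing

open scoped ModuleCat

universe u v w

noncomputable section

/-! ### Differential operators -/

section DiffOp

variable (k : Type*) (R : Type*) [CommRing k] [CommRing R] [Algebra k R]

/-- `k`-linear differential operators on `R` of order at most `j`: order zero means
multiplication by an element of `R`, and `d` has order at most `j + 1` when every commutator
`[d, r]` has order at most `j`. -/
def diffOpOfOrder : ℕ → Set (Module.End k R)
  | 0 => Set.range (Algebra.lmul k R)
  | j + 1 => {d | ∀ r : R, d * Algebra.lmul k R r - Algebra.lmul k R r * d ∈ diffOpOfOrder j}

variable {k R}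

theorem lmul_comm_sub (a r : R) :
    Algebra.lmul k R a * Algebra.lmul k R r - Algebra.lmul k R r * Algebra.lmul k R a = 0 := by
  rw [← map_mul, ← map_mul, mul_comm, sub_self]

theorem zero_mem_diffOpOfOrder (j : ℕ) : (0 : Module.End k R) ∈ diffOpOfOrder k R j := by
  induction j with
  | zero => exact ⟨0, map_zero _⟩
  | succ j ih => intro r; simpa using ih

theorem diffOpOfOrder_le_succ (j : ℕ) : diffOpOfOrder k R j ⊆ diffOpOfOrder k R (j + 1) := by
  induction j with
  | zero =>
    rintro _ ⟨a, rfl⟩ r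
    rw [lmul_comm_sub]
    exact zero_mem_diffOpOfOrder 0
  | succ j ih => intro d hd r; exact ih (hd r)

theorem diffOpOfOrder_mono {i j : ℕ} (h : i ≤ j) : diffOpOfOrder k R i ⊆ diffOpOfOrder k R j :=
  monotone_nat_of_le_succ (f := diffOpOfOrder k R) diffOpOfOrder_le_succ h

theorem add_mem_diffOpOfOrder {j : ℕ} {d d' : Module.End k R} (hd : d ∈ diffOpOfOrder k R j)
    (hd' : d' ∈ diffOpOfOrder k R j) : d + d' ∈ diffOpOfOrder k R j := by
  induction j generalizing d d' with
  | zero =>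
    obtain ⟨a, rfl⟩ := hd
    obtain ⟨b, rfl⟩ := hd'
    exact ⟨a + b, map_add _ _ _⟩
  | succ j ih =>
    intro r
    have := ih (hd r) (hd' r)
    have e : (d + d') * Algebra.lmul k R r - Algebra.lmul k R r * (d + d') =
      (d * Algebra.lmul k R r - Algebra.lmul k R r * d) +
      (d' * Algebra.lmul k R r - Algebra.lmul k R r * d') := by noncomm_ring
    rwa [e]

theorem mul_mem_diffOpOfOrder {n i j : ℕ} (hn : i + j = n) {d d' : Module.End k R}
    (hd : d ∈ diffOpOfOrder k R i) (hd' : d' ∈ diffOpOfOrder k R j) :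
    d * d' ∈ diffOpOfOrder k R n := by
  induction n generalizing i j d d' with
  | zero =>
    obtain ⟨rfl, rfl⟩ : i = 0 ∧ j = 0 := by omega
    obtain ⟨a, rfl⟩ := hd
    obtain ⟨b, rfl⟩ := hd'
    exact ⟨a * b, map_mul _ _ _⟩
  | succ n ih =>
    intro r
    have e : d * d' * Algebra.lmul k R r - Algebra.lmul k R r * (d * d') =
      d * (d' * Algebra.lmul k R r - Algebra.lmul k R r * d') +
      (d * Algebra.lmul k R r - Algebra.lmul k R r * d) * d' := by
      simp only [mul_sub, sub_mul, mul_assoc, sub_add_sub_cancel]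
    rw [e]
    refine add_mem_diffOpOfOrder ?_ ?_
    · cases j with
      | zero =>
        obtain ⟨b, rfl⟩ := hd'
        rw [lmul_comm_sub, mul_zero]
        exact zero_mem_diffOpOfOrder n
      | succ j => exact ih (by omega) hd (hd' r)
    · cases i with
      | zero =>
        obtain ⟨a, rfl⟩ := hd
        rw [lmul_comm_sub, zero_mul]
        exact zero_mem_diffOpOfOrder n
      | succ i => exact ih (by omega) (hd r) hd'

variable (k R)

/-- The ring `𝒟(R, k)` of `k`-linear differential operators on `R`. -/
def diffOp : Subalgebra k (Module.End k R) where
  carrier := ⋃ j, diffOpOfOrder k R j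
  mul_mem' := by
    intro a b ha hb
    obtain ⟨i, hi⟩ := Set.mem_iUnion.1 ha
    obtain ⟨j, hj⟩ := Set.mem_iUnion.1 hb
    exact Set.mem_iUnion.2 ⟨i + j, mul_mem_diffOpOfOrder rfl hi hj⟩
  add_mem' := by
    intro a b ha hb
    obtain ⟨i, hi⟩ := Set.mem_iUnion.1 ha
    obtain ⟨j, hj⟩ := Set.mem_iUnion.1 hb
    exact Set.mem_iUnion.2 ⟨max i j, add_mem_diffOpOfOrder
      (diffOpOfOrder_mono (le_max_left i j) hi) (diffOpOfOrder_mono (le_max_right i j) hj)⟩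
  algebraMap_mem' := by
    intro c
    refine Set.mem_iUnion.2 ⟨0, algebraMap k R c, ?_⟩
    ext x
    simp [Algebra.smul_def]

/-- The inclusion `R → 𝒟(R, k)`, `r ↦` multiplication by `r`. -/
def diffOpOfRing : R →+* diffOp k R :=
  ((Algebra.lmul k R).codRestrict (diffOp k R)
    (fun r => Set.mem_iUnion.2 ⟨0, r, rfl⟩)).toRingHom

/-- The inclusion `R → 𝒟(R, k)ᵒᵖ`, `r ↦` multiplication by `r`. -/
def diffOpOfRingOp : R →+* (diffOp k R)ᵐᵒᵖ :=
  (diffOpOfRing k R).toOpposite fun x y => by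
    rw [commute_iff_eq, ← map_mul, ← map_mul, mul_comm]

theorem diffOpOfRing_algebraMap (c : k) :
    diffOpOfRing k R (algebraMap k R c) = algebraMap k (diffOp k R) c := by
  apply Subtype.ext
  ext x
  change algebraMap k R c * x = c • x
  rw [Algebra.smul_def]

end DiffOp

/-! ### Left and right `𝒟`-modules and the action of a differential operator -/

section DModule

variable {k : Type*} {R : Type*} [Field k] [CommRing R] [Algebra k R]

/-- The `R`-module underlying a left `𝒟(R, k)`-module. -/
def leftUnderlying (M : ModuleCat.{w} (diffOp k R)) : ModuleCat.{w} R :=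
  (ModuleCat.restrictScalars (diffOpOfRing k R)).obj M

/-- The `R`-module underlying a right `𝒟(R, k)`-module. -/
def rightUnderlying (M : ModuleCat.{w} (diffOp k R)ᵐᵒᵖ) : ModuleCat.{w} R :=
  (ModuleCat.restrictScalars (diffOpOfRingOp k R)).obj M

/-- The `k`-linear map `m ↦ δ · m` on a left `𝒟(R, k)`-module. -/
def leftAct (M : ModuleCat.{w} (diffOp k R)) (δ : diffOp k R) :
    leftUnderlying M →ₗ[k] leftUnderlying M where
  toFun m := (δ • (show M from m) : M)
  map_add' x y := smul_add δ (show M from x) (show M from y)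
  map_smul' c x := by
    change δ • (diffOpOfRing k R (algebraMap k R c) • (show M from x)) =
      diffOpOfRing k R (algebraMap k R c) • (δ • (show M from x))
    rw [smul_smul, smul_smul, diffOpOfRing_algebraMap, Algebra.commutes]

/-- The `k`-linear map `m ↦ m · δ` on a right `𝒟(R, k)`-module. -/
def rightAct (M : ModuleCat.{w} (diffOp k R)ᵐᵒᵖ) (δ : diffOp k R) :
    rightUnderlying M →ₗ[k] rightUnderlying M where
  toFun m := (MulOpposite.op δ • (show M from m) : M)
  map_add' x y := smul_add (MulOpposite.op δ) (show M from x) (show M from y)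
  map_smul' c x := by
    change MulOpposite.op δ •
        (MulOpposite.op (diffOpOfRing k R (algebraMap k R c)) • (show M from x)) =
      MulOpposite.op (diffOpOfRing k R (algebraMap k R c)) • (MulOpposite.op δ • (show M from x))
    rw [smul_smul, smul_smul, diffOpOfRing_algebraMap, ← MulOpposite.op_mul,
      ← MulOpposite.op_mul, Algebra.commutes]

/-- A morphism of left `𝒟(R, k)`-modules, as an `R`-linear map. -/
def leftHom {M N : ModuleCat.{w} (diffOp k R)} (f : M ⟶ N) :
    leftUnderlying M →ₗ[R] leftUnderlying N where
  toFun m := f.hom (show M from m)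
  map_add' x y := f.hom.map_add (show M from x) (show M from y)
  map_smul' r x := f.hom.map_smul (diffOpOfRing k R r) (show M from x)

/-- A morphism of right `𝒟(R, k)`-modules, as an `R`-linear map. -/
def rightHom {M N : ModuleCat.{w} (diffOp k R)ᵐᵒᵖ} (f : M ⟶ N) :
    rightUnderlying M →ₗ[R] rightUnderlying N where
  toFun m := f.hom (show M from m)
  map_add' x y := f.hom.map_add (show M from x) (show M from y)
  map_smul' r x := f.hom.map_smul (diffOpOfRingOp k R r) (show M from x)

end DModule

/-! ### Injective hulls, `Σ`-continuous maps and Matlis duals -/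

/-- `E` is an injective hull of `N`: an injective module that is an essential extension
of `N`. The universe of `E` is large enough for `Module.Injective` to be injectivity. -/
def IsInjectiveHull (R : Type u) [CommRing R] (N : Type*) [AddCommGroup N] [Module R N]
    (E : Type (max u v)) [AddCommGroup E] [Module R E] : Prop :=
  Module.Injective R E ∧ ∃ i : N →ₗ[R] E, Function.Injective i ∧
    ∀ L : Submodule R E, L ≠ ⊥ → L ⊓ LinearMap.range i ≠ ⊥

section Matlis

variable {k : Type*} {R : Type*} [Field k] [CommRing R] [IsLocalRing R] [Algebra k R]

variable (R) in
/-- The socle `(0 :_E 𝔪)`. -/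
def socle (E : Type*) [AddCommGroup E] [Module R E] : Submodule R E :=
  Submodule.torsionBySet R E (maximalIdeal R : Set R)

/-- A `k`-linear projection of `E` onto its socle, followed by an identification of the
one-dimensional socle with the residue field: a `k`-linear map that restricts to a bijection from
the socle. -/
def IsSocleProjection {E : Type*} [AddCommGroup E] [Module R E] [Module k E]
    (σ : E →ₗ[k] ResidueField R) : Prop :=
  Function.Bijective fun x : socle R E => σ (x : E)

/-- `Σ`-continuity of a `k`-linear map between `R`-modules. -/
def IsSigmaContinuous (R : Type*) [CommRing R] [IsLocalRing R] [Algebra k R]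
    {M N : Type*} [AddCommGroup M] [Module R M] [Module k M]
    [AddCommGroup N] [Module R N] [Module k N] (δ : M →ₗ[k] N) : Prop :=
  ∀ L : Submodule R M, L.FG →
    (Submodule.span R (δ '' (L : Set M))).FG ∧
    ∀ t : ℕ, ∃ s : ℕ, ∀ x ∈ (maximalIdeal R) ^ s • L,
      δ x ∈ (maximalIdeal R) ^ t • Submodule.span R (δ '' (L : Set M))

/-- The `Σ`-continuous dual: the `Σ`-continuous `k`-linear maps from `N` to the residue field. -/
def sigmaDual (k R : Type*) [Field k] [CommRing R] [IsLocalRing R] [Algebra k R]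
    (N : Type*) [AddCommGroup N] [Module R N] [Module k N] : Set (N →ₗ[k] ResidueField R) :=
  {l | IsSigmaContinuous R l}

variable {E : Type*} [AddCommGroup E] [Module R E] [Module k E] [IsScalarTower k R E]
  {M : Type*} [AddCommGroup M] [Module R M] [Module k M] [IsScalarTower k R M]
  {N : Type*} [AddCommGroup N] [Module R N] [Module k N] [IsScalarTower k R N]

/-- The map `Φ_N` sending `φ : N → E` to `σ ∘ φ`. -/
def matlisPhi (σ : E →ₗ[k] ResidueField R) (φ : N →ₗ[R] E) : N →ₗ[k] ResidueField R :=
  σ ∘ₗ φ.restrictScalars k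

/-- The Matlis dual `δ^* = Φ_M⁻¹ ∘ δ^∨ ∘ Φ_N` of a `Σ`-continuous map `δ : M → N`, where `δ^∨` is
precomposition with `δ`. -/
def matlisDual (σ : E →ₗ[k] ResidueField R) (δ : M →ₗ[k] N) (φ : N →ₗ[R] E) : M →ₗ[R] E :=
  Function.invFun (matlisPhi (N := M) σ) (matlisPhi σ φ ∘ₗ δ)

end Matlis

end

/-! ### Matlis functionals: `σ ∘ φ` and Σ-continuity -/

section MatlisPhi

variable {k : Type*} {R : Type u} {E : Type (max u v)} [Field k] [CommRing R] [IsLocalRing R]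
  [Algebra k R] [AddCommGroup E] [Module R E]

/-! Three facts carry the theorem. Bijectivity of `matlisPhi`: a submodule of `E` on which `σ`
vanishes meets the socle trivially, hence is zero by essentiality, so `x` is determined by the
values `σ (r • x)`. Conversely, a functional killing a power of `𝔪` on a module lifts by induction
on the exponent, using injectivity of `E` (`exists_matlisPhi_eq_of_pow_smul`). A Σ-continuous
functional has this property on each cyclic submodule, and uniqueness glues the cyclic lifts.
Σ-continuity of the action: operators of bounded order form a Noetherian left `R`-module. Indeed an
operator killing `1` and commuting with generators of `𝔪` is zero (`eq_zero_of_comm_generators`), so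
`δ ↦ (δ 1, [δ, x_i])` embeds each step of the order filtration in a finite product of Noetherian
modules. Hence `R δ R` is finitely generated, which gives the finiteness half; commutator induction
gives the `𝔪`-adic half. Right modules follow because left and right multiplication agree modulo
lower order. Module axioms and functoriality: by `matlisDual_eq_iff`, an equation about `δ^*`
amounts to an identity of functionals, where `δ^*` is precomposition with `δ`. -/

theorem IsInjectiveHull.baer (hE : IsInjectiveHull.{u, v} R (ResidueField R) E) :
    Module.Baer R E :=
  Module.Baer.of_injective hE.1

theorem mem_socle {x : E} : x ∈ socle R E ↔ ∀ a ∈ maximalIdeal R, a • x = 0 := by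
  simp [socle, Submodule.mem_torsionBySet_iff]

theorem IsInjectiveHull.inf_socle_ne_bot (hE : IsInjectiveHull.{u, v} R (ResidueField R) E)
    {L : Submodule R E} (hL : L ≠ ⊥) : L ⊓ socle R E ≠ ⊥ := by
  obtain ⟨-, i, -, hi⟩ := hE
  refine fun h => hi L hL (eq_bot_iff.2 (le_trans (inf_le_inf_left L ?_) h.le))
  rintro _ ⟨x, rfl⟩
  refine mem_socle.2 fun a ha => ?_
  rw [← map_smul, Algebra.smul_def, ResidueField.algebraMap_eq, (residue_eq_zero_iff a).2 ha,
    zero_mul, map_zero]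

/-- A finitely generated submodule of an injective hull of the residue field is killed by a power
of the maximal ideal. -/
theorem IsInjectiveHull.exists_pow_smul_eq_bot [IsNoetherianRing R]
    (hE : IsInjectiveHull.{u, v} R (ResidueField R) E) {P : Submodule R E} (hP : P.FG) :
    ∃ s : ℕ, maximalIdeal R ^ s • P = ⊥ := by
  have : Module.Finite R P := Module.Finite.iff_fg.2 hP
  -- Artin–Rees for the socle of `P`: `𝔪^(c+1) P ∩ soc = 𝔪 (𝔪^c P ∩ soc) = 0`. Essentiality then
  -- forces `𝔪^(c+1) P = 0`.
  obtain ⟨c, hc⟩ := (maximalIdeal R).exists_pow_inf_eq_pow_smul ((socle R E).comap P.subtype)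
  refine ⟨c + 1, by_contra fun h => hE.inf_socle_ne_bot h (eq_bot_iff.2 ?_)⟩
  rintro x ⟨hx, hxs⟩
  have hxP : x ∈ P := Submodule.smul_le_right hx
  have h1 : (⟨x, hxP⟩ : P) ∈ maximalIdeal R ^ (c + 1) • (⊤ : Submodule R P) ⊓
      (socle R E).comap P.subtype := by
    refine ⟨?_, hxs⟩
    have e : (maximalIdeal R ^ (c + 1) • (⊤ : Submodule R P)).map P.subtype =
        maximalIdeal R ^ (c + 1) • P := by
      rw [Submodule.map_smul'', Submodule.map_top, Submodule.range_subtype]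
    rw [← e] at hx
    obtain ⟨y, hy, rfl⟩ := hx
    exact hy
  rw [hc (c + 1) (Nat.le_succ c), Nat.add_sub_cancel_left, pow_one] at h1
  have h2 : maximalIdeal R • (maximalIdeal R ^ c • (⊤ : Submodule R P) ⊓
      (socle R E).comap P.subtype) ≤ ⊥ := by
    refine Submodule.smul_le.2 fun a ha y hy => ?_
    exact Subtype.ext (mem_socle.1 hy.2 a ha)
  exact congrArg Subtype.val ((Submodule.mem_bot R).1 (h2 h1))

theorem smul_residueField_eq_bot (V : Submodule R (ResidueField R)) :
    maximalIdeal R • V = ⊥ := by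
  refine eq_bot_iff.2 (Submodule.smul_le.2 fun a ha y _ => ?_)
  rw [Submodule.mem_bot, Algebra.smul_def, ResidueField.algebraMap_eq,
    (residue_eq_zero_iff a).2 ha, zero_mul]

/-- Since `𝔪` kills the residue field, Σ-continuity at `t = 1` already says that `l` vanishes on
`𝔪^s L`; this in turn settles every `t`. -/
theorem isSigmaContinuous_residueField_iff [IsNoetherianRing R] {N : Type*} [AddCommGroup N]
    [Module R N] [Module k N] (l : N →ₗ[k] ResidueField R) :
    IsSigmaContinuous R l ↔ ∀ L : Submodule R N, L.FG →
      ∃ s : ℕ, ∀ x ∈ maximalIdeal R ^ s • L, l x = 0 := by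
  constructor
  · intro h L hL
    obtain ⟨s, hs⟩ := (h L hL).2 1
    refine ⟨s, fun x hx => ?_⟩
    have := hs x hx
    rwa [pow_one, smul_residueField_eq_bot, Submodule.mem_bot] at this
  · intro h L hL
    refine ⟨?_, fun t => ?_⟩
    · have : IsNoetherian R (ResidueField R) :=
        isNoetherian_of_surjective (Algebra.linearMap R (ResidueField R))
          (LinearMap.range_eq_top.2 residue_surjective)
      exact IsNoetherian.noetherian _
    · obtain ⟨s, hs⟩ := h L hL
      exact ⟨s, fun x hx => by rw [hs x hx]; exact zero_mem _⟩

variable [Module k E] {σ : E →ₗ[k] ResidueField R}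

theorem eq_bot_of_forall_socleProjection_eq_zero (hE : IsInjectiveHull.{u, v} R (ResidueField R) E)
    (hσ : IsSocleProjection σ) {L : Submodule R E} (h : ∀ x ∈ L, σ x = 0) : L = ⊥ := by
  by_contra hL
  refine hE.inf_socle_ne_bot hL (eq_bot_iff.2 ?_)
  rintro x ⟨hx, hxs⟩
  have : (⟨x, hxs⟩ : socle R E) = 0 := hσ.1 (by simpa using h x hx)
  exact congrArg Subtype.val this

/-- `σ` vanishes on the cyclic submodule spanned by `x - y`, which must then be zero. This is the
uniqueness principle behind both injectivity and linearity of lifts. -/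
theorem eq_of_forall_socleProjection_smul_eq (hE : IsInjectiveHull.{u, v} R (ResidueField R) E)
    (hσ : IsSocleProjection σ) {x y : E} (h : ∀ r : R, σ (r • x) = σ (r • y)) : x = y := by
  have : Submodule.span R {x - y} = ⊥ := by
    refine eq_bot_of_forall_socleProjection_eq_zero hE hσ fun z hz => ?_
    obtain ⟨r, rfl⟩ := Submodule.mem_span_singleton.1 hz
    rw [smul_sub, map_sub, h r, sub_self]
  exact sub_eq_zero.1 (Submodule.span_singleton_eq_bot.1 this)

variable [IsScalarTower k R E]

theorem matlisPhi_injective (hE : IsInjectiveHull.{u, v} R (ResidueField R) E)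
    (hσ : IsSocleProjection σ) {N : Type*} [AddCommGroup N] [Module R N] [Module k N]
    [IsScalarTower k R N] : Function.Injective (matlisPhi (N := N) σ) := by
  intro φ ψ h
  ext n
  refine eq_of_forall_socleProjection_smul_eq hE hσ fun r => ?_
  simpa [matlisPhi] using LinearMap.congr_fun h (r • n)

theorem exists_algebraMap_add_mem_maximalIdeal
    (hk : Function.Bijective (algebraMap k (ResidueField R))) (r : R) :
    ∃ c : k, ∃ a ∈ maximalIdeal R, r = algebraMap k R c + a := by
  obtain ⟨c, hc⟩ := hk.2 (residue R r)
  refine ⟨c, r - algebraMap k R c, ?_, by ring⟩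
  rw [← residue_eq_zero_iff, map_sub, ← hc, IsScalarTower.algebraMap_apply k R (ResidueField R)]
  exact sub_self _

/-- A `k`-linear functional killing `𝔪 ^ s • N` is of the form `σ ∘ φ`. -/
theorem exists_matlisPhi_eq_of_pow_smul
    (hk : Function.Bijective (algebraMap k (ResidueField R)))
    (hE : IsInjectiveHull.{u, v} R (ResidueField R) E) (hσ : IsSocleProjection σ) (s : ℕ)
    (N : Type w) [AddCommGroup N] [Module R N] [Module k N] [IsScalarTower k R N]
    (l : N →ₗ[k] ResidueField R)
    (hl : ∀ x ∈ maximalIdeal R ^ s • (⊤ : Submodule R N), l x = 0) :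
    ∃ φ : N →ₗ[R] E, matlisPhi σ φ = l := by
  induction s generalizing N with
  | zero =>
    refine ⟨0, ?_⟩
    ext x
    rw [hl x (by simp)]
    simp [matlisPhi]
  | succ s ih =>
    set P : Submodule R N := maximalIdeal R • (⊤ : Submodule R N)
    obtain ⟨φ', hφ'⟩ := ih P (l ∘ₗ P.subtype.restrictScalars k) fun x hx => by
      refine hl x ?_
      have := Submodule.mem_map_of_mem (f := P.subtype) hx
      rw [Submodule.map_smul'', Submodule.map_top, Submodule.range_subtype] at this
      rwa [pow_succ, Submodule.mul_smul]
    -- The lift on `𝔪 N` extends to `N` by injectivity of `E`. The error `l'` vanishes on `𝔪 N`, so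
    -- only a socle-valued correction remains.
    obtain ⟨φ, rfl⟩ := hE.baer.extension_property P.subtype P.injective_subtype φ'
    let l' : N →ₗ[k] ResidueField R := l - matlisPhi σ φ
    have hl' : ∀ x ∈ P, l' x = 0 := fun x hx =>
      sub_eq_zero.2 (LinearMap.congr_fun hφ' ⟨x, hx⟩).symm
    let τ := Equiv.ofBijective _ hσ
    have hτ : ∀ y, σ (τ.symm y : E) = y := fun y => τ.apply_symm_apply y
    have hτ_inj : ∀ {x y : E}, x ∈ socle R E → y ∈ socle R E → σ x = σ y → x = y :=
      fun {x y} hx hy h => congrArg Subtype.val (hσ.1 (a₁ := ⟨x, hx⟩) (a₂ := ⟨y, hy⟩) h)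
    have hc : ∀ (c : k) {x : E}, x ∈ socle R E → c • x ∈ socle R E := fun c x hx => by
      rw [← algebraMap_smul R c x]
      exact Submodule.smul_mem _ _ hx
    -- The correction is `l'` transported through the bijection of the socle with the residue field.
    -- Writing `r = c + a` with `c ∈ k` and `a ∈ 𝔪`, both sides of linearity lose the `a` term, so
    -- `k`-linearity suffices.
    let ψ : N →ₗ[R] E :=
      { toFun := fun n => (τ.symm (l' n) : E)
        map_add' := fun x y => hτ_inj (Subtype.prop _)
          (add_mem (Subtype.prop _) (Subtype.prop _)) (by rw [hτ, map_add, map_add, hτ, hτ])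
        map_smul' := fun r x => by
          obtain ⟨c, a, ha, rfl⟩ := exists_algebraMap_add_mem_maximalIdeal hk r
          rw [RingHom.id_apply, add_smul, add_smul, mem_socle.1 (Subtype.prop _) a ha, add_zero,
            map_add, hl' _ (Submodule.smul_mem_smul ha trivial), add_zero, algebraMap_smul,
            algebraMap_smul]
          exact hτ_inj (Subtype.prop _) (hc c (Subtype.prop _))
            (by rw [hτ, map_smul, map_smul, hτ]) }
    refine ⟨φ + ψ, ?_⟩
    ext n
    change σ (φ n + τ.symm (l' n)) = l n
    rw [map_add, hτ]
    change σ (φ n) + (l n - σ (φ n)) = l n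
    abel

/-- The image `φ L` is finitely generated in `E`, hence killed by a power of `𝔪`. -/
theorem matlisPhi_mem_sigmaDual [IsNoetherianRing R]
    (hE : IsInjectiveHull.{u, v} R (ResidueField R) E) {N : Type*} [AddCommGroup N] [Module R N]
    [Module k N] [IsScalarTower k R N] (φ : N →ₗ[R] E) : matlisPhi σ φ ∈ sigmaDual k R N := by
  refine (isSigmaContinuous_residueField_iff _).2 fun L hL => ?_
  obtain ⟨s, hs⟩ := hE.exists_pow_smul_eq_bot (hL.map φ)
  refine ⟨s, fun x hx => ?_⟩
  have := Submodule.mem_map_of_mem (f := φ) hx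
  rw [Submodule.map_smul'', hs, Submodule.mem_bot] at this
  change σ (φ x) = 0
  rw [this, map_zero]

theorem exists_matlisPhi_eq [IsNoetherianRing R]
    (hk : Function.Bijective (algebraMap k (ResidueField R)))
    (hE : IsInjectiveHull.{u, v} R (ResidueField R) E) (hσ : IsSocleProjection σ)
    {N : Type*} [AddCommGroup N] [Module R N] [Module k N] [IsScalarTower k R N]
    {l : N →ₗ[k] ResidueField R} (hl : l ∈ sigmaDual k R N) :
    ∃ φ : N →ₗ[R] E, matlisPhi σ φ = l := by
  -- The functional `r ↦ l (r • n)` on `R` kills a power of `𝔪`; if it lifts to `φ : R → E`, take `e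
  -- = φ 1`.
  have key : ∀ n : N, ∃ e : E, ∀ r : R, σ (r • e) = l (r • n) := fun n => by
    obtain ⟨s, hs⟩ := (isSigmaContinuous_residueField_iff l).1 hl (Submodule.span R {n})
      (Submodule.fg_span_singleton n)
    let g : R →ₗ[R] N := LinearMap.toSpanSingleton R N n
    obtain ⟨φ, hφ⟩ := exists_matlisPhi_eq_of_pow_smul hk hE hσ s R
      (l ∘ₗ g.restrictScalars k) fun x hx => hs _ (by
        have := Submodule.mem_map_of_mem (f := g) hx
        rwa [Submodule.map_smul'', Submodule.map_top, LinearMap.range_toSpanSingleton] at this)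
    refine ⟨φ 1, fun r => ?_⟩
    have := LinearMap.congr_fun hφ r
    change σ (φ r) = l (r • n) at this
    rw [← this, ← map_smul, smul_eq_mul, mul_one]
  choose f hf using key
  refine ⟨{ toFun := f, map_add' := fun x y => ?_, map_smul' := fun r x => ?_ }, ?_⟩
  · refine eq_of_forall_socleProjection_smul_eq hE hσ fun r => ?_
    rw [hf, smul_add, smul_add, map_add, map_add, hf, hf]
  · refine eq_of_forall_socleProjection_smul_eq hE hσ fun r' => ?_
    rw [hf, RingHom.id_apply, smul_smul, smul_smul, hf]
  · ext n
    simpa [matlisPhi] using hf n 1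

theorem matlisPhi_bijOn [IsNoetherianRing R]
    (hk : Function.Bijective (algebraMap k (ResidueField R)))
    (hE : IsInjectiveHull.{u, v} R (ResidueField R) E) (hσ : IsSocleProjection σ)
    (N : Type*) [AddCommGroup N] [Module R N] [Module k N] [IsScalarTower k R N] :
    Set.BijOn (matlisPhi (N := N) σ) Set.univ (sigmaDual k R N) :=
  ⟨fun φ _ => matlisPhi_mem_sigmaDual hE φ, (matlisPhi_injective hE hσ).injOn,
    fun _ hl => (exists_matlisPhi_eq hk hE hσ hl).imp fun _ h => ⟨trivial, h⟩⟩

theorem IsSigmaContinuous.comp_mem_sigmaDual [IsNoetherianRing R] {M N : Type*} [AddCommGroup M]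
    [Module R M] [Module k M] [AddCommGroup N] [Module R N] [Module k N] {δ : M →ₗ[k] N}
    (hδ : IsSigmaContinuous R δ) {l : N →ₗ[k] ResidueField R} (hl : l ∈ sigmaDual k R N) :
    l ∘ₗ δ ∈ sigmaDual k R M := by
  refine (isSigmaContinuous_residueField_iff _).2 fun L hL => ?_
  obtain ⟨t, ht⟩ := (isSigmaContinuous_residueField_iff l).1 hl _ (hδ L hL).1
  obtain ⟨s, hs⟩ := (hδ L hL).2 t
  exact ⟨s, fun x hx => ht _ (hs x hx)⟩

variable {M : Type*} [AddCommGroup M] [Module R M] [Module k M] [IsScalarTower k R M]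
  {N : Type*} [AddCommGroup N] [Module R N] [Module k N] [IsScalarTower k R N]

/-- `Function.invFun` is a true inverse only on the range of `matlisPhi`; Σ-continuity of `δ` puts
the precomposed functional in that range. -/
theorem matlisPhi_matlisDual [IsNoetherianRing R]
    (hk : Function.Bijective (algebraMap k (ResidueField R)))
    (hE : IsInjectiveHull.{u, v} R (ResidueField R) E) (hσ : IsSocleProjection σ)
    {δ : M →ₗ[k] N} (hδ : IsSigmaContinuous R δ) (φ : N →ₗ[R] E) :
    matlisPhi σ (matlisDual σ δ φ) = matlisPhi σ φ ∘ₗ δ :=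
  Function.invFun_eq (exists_matlisPhi_eq hk hE hσ
    (hδ.comp_mem_sigmaDual (matlisPhi_mem_sigmaDual hE φ)))

theorem matlisDual_eq_iff [IsNoetherianRing R]
    (hk : Function.Bijective (algebraMap k (ResidueField R)))
    (hE : IsInjectiveHull.{u, v} R (ResidueField R) E) (hσ : IsSocleProjection σ)
    {δ : M →ₗ[k] N} (hδ : IsSigmaContinuous R δ) {φ : N →ₗ[R] E} {ψ : M →ₗ[R] E} :
    matlisDual σ δ φ = ψ ↔ ∀ x, σ (φ (δ x)) = σ (ψ x) := by
  rw [← (matlisPhi_injective hE hσ).eq_iff, matlisPhi_matlisDual hk hE hσ hδ, LinearMap.ext_iff]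
  rfl

theorem socleProjection_matlisDual_apply [IsNoetherianRing R]
    (hk : Function.Bijective (algebraMap k (ResidueField R)))
    (hE : IsInjectiveHull.{u, v} R (ResidueField R) E) (hσ : IsSocleProjection σ)
    {δ : M →ₗ[k] N} (hδ : IsSigmaContinuous R δ) (φ : N →ₗ[R] E) (x : M) :
    σ (matlisDual σ δ φ x) = σ (φ (δ x)) :=
  ((matlisDual_eq_iff hk hE hσ hδ).1 rfl x).symm

theorem isSigmaContinuous_restrictScalars (f : M →ₗ[R] N) :
    IsSigmaContinuous R (f.restrictScalars k) := by
  intro L hL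
  have e : Submodule.span R (f.restrictScalars k '' (L : Set M)) = L.map f :=
    Submodule.span_eq (L.map f)
  refine ⟨e ▸ hL.map f, fun t => ⟨t, fun x hx => ?_⟩⟩
  rw [e, ← Submodule.map_smul'']
  exact Submodule.mem_map_of_mem hx

end MatlisPhi

/-! ### The commutator filtration and its finiteness -/

section CommutatorOrder

variable {R : Type*} {A : Type*} [CommRing R] [Ring A] [Module R A]

/-- For `ι : R → A` whose image acts on `A` by left multiplication, the `R`-submodule of the
elements whose iterated commutators of length `j` with elements of `R` all vanish. -/
def commutatorOrder (ι : R →+* A) (hι : ∀ (r : R) (a : A), r • a = ι r * a) : ℕ → Submodule R A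
  | 0 => ⊥
  | j + 1 =>
    { carrier := {d | ∀ r : R, d * ι r - ι r * d ∈ commutatorOrder ι hι j}
      add_mem' := fun {a b} ha hb r => by
        have := add_mem (ha r) (hb r)
        rwa [show a * ι r - ι r * a + (b * ι r - ι r * b) = (a + b) * ι r - ι r * (a + b) by
          noncomm_ring] at this
      zero_mem' := fun r => by simp
      smul_mem' := fun c a ha r => by
        have := (commutatorOrder ι hι j).smul_mem c (ha r)
        rwa [show c • (a * ι r - ι r * a) = c • a * ι r - ι r * (c • a) by
          simp only [hι, mul_sub, ← mul_assoc, ← map_mul, mul_comm c r]] at this }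

variable {ι : R →+* A} {hι : ∀ (r : R) (a : A), r • a = ι r * a}

theorem mem_commutatorOrder_zero {a : A} : a ∈ commutatorOrder ι hι 0 ↔ a = 0 := by
  rw [commutatorOrder, Submodule.mem_bot]

theorem mem_commutatorOrder_succ {j : ℕ} {a : A} : a ∈ commutatorOrder ι hι (j + 1) ↔
    ∀ r : R, a * ι r - ι r * a ∈ commutatorOrder ι hι j := by
  rw [commutatorOrder]
  rfl

theorem mul_mem_commutatorOrder {j : ℕ} {a : A} (ha : a ∈ commutatorOrder ι hι j) (r : R) :
    a * ι r ∈ commutatorOrder ι hι j := by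
  induction j generalizing a with
  | zero => rw [mem_commutatorOrder_zero.1 ha, zero_mul]; exact zero_mem _
  | succ j ih =>
    refine mem_commutatorOrder_succ.2 fun r' => ?_
    have := ih (mem_commutatorOrder_succ.1 ha r')
    rwa [show (a * ι r' - ι r' * a) * ι r = a * ι r * ι r' - ι r' * (a * ι r) by
      rw [sub_mul, mul_assoc, mul_assoc, mul_assoc, ← map_mul, ← map_mul, mul_comm r' r]] at this

variable (ι hι) in
/-- The `R`-linear map `a ↦ [a, r]`. -/
def commutatorOrderMap (j : ℕ) (r : R) :
    commutatorOrder ι hι (j + 1) →ₗ[R] commutatorOrder ι hι j where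
  toFun a := ⟨a * ι r - ι r * a, mem_commutatorOrder_succ.1 a.2 r⟩
  map_add' a b := Subtype.ext <| by
    simp only [Submodule.coe_add, add_mul, mul_add]
    abel
  map_smul' c a := Subtype.ext <| by
    simp only [hι, Submodule.coe_smul, RingHom.id_apply, mul_sub, ← mul_assoc, ← map_mul,
      mul_comm c r]

/-- If the elements of `A` are detected by a functional and by the commutators with finitely many
elements of `R`, then the elements of bounded commutator order form a Noetherian module. -/
theorem isNoetherian_commutatorOrder [IsNoetherianRing R] {n : ℕ} (x : Fin n → R) (ev : A →ₗ[R] R)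
    (h : ∀ a : A, ev a = 0 → (∀ i, a * ι (x i) = ι (x i) * a) → a = 0) (j : ℕ) :
    IsNoetherian R (commutatorOrder ι hι j) := by
  induction j with
  | zero => rw [commutatorOrder]; infer_instance
  | succ j ih =>
    -- The embedding is `a ↦ (ev a, [a, x_i])` into `R × (order j)^n`, Noetherian by induction.
    refine isNoetherian_of_injective ((ev ∘ₗ Submodule.subtype _).prod
      (LinearMap.pi fun i => commutatorOrderMap ι hι j (x i))) ?_
    refine (injective_iff_map_eq_zero _).2 fun a ha => Subtype.ext (h a ?_ fun i => ?_)
    · exact congrArg Prod.fst ha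
    · exact sub_eq_zero.1 (congrArg Subtype.val (congrFun (congrArg Prod.snd ha) i))

/-- An anti-isomorphism sends a commutator to minus a commutator, and submodules are stable under
sign. -/
theorem antiEquiv_mem_commutatorOrder {B : Type*} [Ring B] [Module R B] {ι' : R →+* B}
    {hι' : ∀ (r : R) (b : B), r • b = ι' r * b} (e : A ≃+ B) (he : ∀ a b, e (a * b) = e b * e a)
    (h : ∀ r, ι' r = e (ι r))
    {j : ℕ} {a : A} : e a ∈ commutatorOrder ι' hι' j ↔ a ∈ commutatorOrder ι hι j := by
  induction j generalizing a with
  | zero => simp [mem_commutatorOrder_zero]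
  | succ j ih =>
    rw [mem_commutatorOrder_succ, mem_commutatorOrder_succ]
    refine forall_congr' fun r => ?_
    rw [← neg_mem_iff, ← ih, h, ← he, ← he, ← map_sub,
      ← map_neg, neg_sub]

/-- Noetherianity of bounded commutator order passes from the left to the right module structure,
since the two structures agree on the successive quotients. -/
theorem isNoetherian_commutatorOrder_of_antiEquiv {B : Type*} [Ring B] [Module R B] {ι' : R →+* B}
    {hι' : ∀ (r : R) (b : B), r • b = ι' r * b} (e : A ≃+ B) (he : ∀ a b, e (a * b) = e b * e a)
    (h : ∀ r, ι' r = e (ι r))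
    (hN : ∀ j, IsNoetherian R (commutatorOrder ι hι j)) (j : ℕ) :
    IsNoetherian R (commutatorOrder ι' hι' j) := by
  induction j with
  | zero => rw [commutatorOrder]; infer_instance
  | succ j ih =>
    set P := commutatorOrder ι' hι' (j + 1)
    let S : Submodule R P := (commutatorOrder ι' hι' j).comap P.subtype
    have := hN (j + 1)
    -- `e` becomes `R`-linear modulo `S`: `e (r • a) - r • e a` is, up to sign, `e` of the
    -- commutator `[a, r]`, which has order `j`.
    let f : commutatorOrder ι hι (j + 1) →ₗ[R] P ⧸ S :=
      { toFun := fun a => S.mkQ ⟨e (a : A), (antiEquiv_mem_commutatorOrder e he h).2 a.2⟩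
        map_add' := fun a b => by
          rw [← map_add]
          exact congrArg S.mkQ (Subtype.ext (map_add e (a : A) b))
        map_smul' := fun r a => by
          rw [RingHom.id_apply, ← map_smul]
          refine (Submodule.Quotient.eq S).2 ?_
          change e (r • (a : A)) - r • e (a : A) ∈
            commutatorOrder ι' hι' j
          rw [hι, hι', h, ← he, ← map_sub, antiEquiv_mem_commutatorOrder e he h,
            ← neg_mem_iff, neg_sub]
          exact mem_commutatorOrder_succ.1 a.2 r }
    have hf : LinearMap.range f = ⊤ := by
      refine LinearMap.range_eq_top.2 fun y => ?_
      obtain ⟨⟨a, ha⟩, rfl⟩ := S.mkQ_surjective y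
      exact ⟨⟨e.symm a, (antiEquiv_mem_commutatorOrder e he h).1 (by rwa [e.apply_symm_apply])⟩,
        congrArg S.mkQ (Subtype.ext (e.apply_symm_apply a))⟩
    refine (isNoetherian_iff_submodule_quotient S).2
      ⟨?_, isNoetherian_of_surjective f hf⟩
    exact isNoetherian_of_injective
      ((P.subtype ∘ₗ S.subtype).codRestrict (commutatorOrder ι' hι' j) fun a => a.2)
      fun a b hab => Subtype.ext (Subtype.ext (Subtype.ext_iff.1 hab :))

theorem span_range_mul_fg {j : ℕ} (hN : IsNoetherian R (commutatorOrder ι hι j)) {a : A}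
    (ha : a ∈ commutatorOrder ι hι j) :
    (Submodule.span R (Set.range fun r : R => a * ι r)).FG := by
  refine isNoetherian_submodule.1 hN _ (Submodule.span_le.2 ?_)
  rintro _ ⟨r, rfl⟩
  exact mul_mem_commutatorOrder ha r

variable {M : Type*} [AddCommGroup M] [Module A M] [Module R M]

/-- If the bimodule generated by `δ` is finitely generated, then `δ` maps finitely generated
submodules into finitely generated submodules. -/
theorem span_smul_image_fg (hι : ∀ (r : R) (a : A), r • a = ι r * a)
    (hM : ∀ (r : R) (m : M), r • m = ι r • m) {δ : A}
    (hδ : (Submodule.span R (Set.range fun r : R => δ * ι r)).FG) {L : Submodule R M} (hL : L.FG) :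
    (Submodule.span R ((δ • ·) '' (L : Set M))).FG := by
  obtain ⟨S, rfl⟩ := hL
  let ev : M → A →ₗ[R] M := fun m =>
    { toFun := fun a => a • m
      map_add' := fun a b => add_smul a b m
      map_smul' := fun r a => by rw [hι, mul_smul, RingHom.id_apply, hM] }
  -- As `δ (c • m) = (δ * ι c) • m`, the span is the sum, over generators `m` of `L`, of the images
  -- of `R δ R` under evaluation at `m`.
  have e : Submodule.span R ((δ • ·) '' (Submodule.span R (S : Set M) : Set M)) =
      ⨆ m ∈ S, (Submodule.span R (Set.range fun r : R => δ * ι r)).map (ev m) := by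
    apply le_antisymm
    · refine Submodule.span_le.2 ?_
      rintro _ ⟨m, hm, rfl⟩
      obtain ⟨c, -, rfl⟩ := Submodule.mem_span_finset.1 hm
      simp only [Finset.smul_sum]
      refine sum_mem fun m hm => ?_
      refine Submodule.mem_iSup_of_mem m (Submodule.mem_iSup_of_mem hm ?_)
      refine ⟨δ * ι (c m), Submodule.subset_span ⟨c m, rfl⟩, ?_⟩
      change (δ * ι (c m)) • m = _
      rw [mul_smul, hM]
    · refine iSup₂_le fun m hm => ?_
      rw [Submodule.map_span_le]
      rintro _ ⟨r, rfl⟩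
      change (δ * ι r) • m ∈ _
      rw [mul_smul, ← hM]
      exact Submodule.subset_span
        ⟨r • m, Submodule.smul_mem _ _ (Submodule.subset_span hm), rfl⟩
  rw [e]
  exact Submodule.fg_biSup _ _ fun m _ => hδ.map _

/-- Double induction on `j` and `s` through `δ r y = r δ y + [δ, r] y`: the first term gains a
factor of `I`, the second has lower commutator order and lands in the span of `δ L`, since `[δ, r] z
= δ (r z) - r δ z`. -/
theorem smul_mem_pow_smul_span (hM : ∀ (r : R) (m : M), r • m = ι r • m) (I : Ideal R) {j : ℕ}
    (s : ℕ) {δ : A} (hδ : δ ∈ commutatorOrder ι hι j) {L : Submodule R M} {x : M}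
    (hx : x ∈ I ^ (s + j) • L) : δ • x ∈ I ^ s • Submodule.span R ((δ • ·) '' (L : Set M)) := by
  induction j generalizing δ s x with
  | zero =>
    rw [mem_commutatorOrder_zero.1 hδ, zero_smul]
    exact zero_mem _
  | succ j ih =>
    induction s generalizing x with
    | zero =>
      rw [pow_zero, Ideal.one_eq_top, Submodule.top_smul]
      exact Submodule.subset_span ⟨x, Submodule.smul_le_right hx, rfl⟩
    | succ s ihs =>
      rw [show s + 1 + (j + 1) = s + (j + 1) + 1 by omega, pow_succ', Submodule.mul_smul] at hx
      refine Submodule.smul_induction_on hx (fun r hr y hy => ?_) fun y z hy hz => ?_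
      · have e : δ • r • y = r • δ • y + (δ * ι r - ι r * δ) • y := by
          rw [hM, hM, sub_smul, mul_smul, mul_smul]
          abel
        rw [e]
        refine add_mem ?_ ?_
        · rw [pow_succ', Submodule.mul_smul]
          exact Submodule.smul_mem_smul hr (ihs hy)
        · have h1 := ih (s + 1) (mem_commutatorOrder_succ.1 hδ r) (x := y)
            (by rwa [show s + 1 + j = s + (j + 1) by omega])
          refine Submodule.smul_mono le_rfl (Submodule.span_le.2 ?_) h1
          rintro _ ⟨z, hz, rfl⟩
          change (δ * ι r - ι r * δ) • z ∈ _
          rw [sub_smul, mul_smul, mul_smul, ← hM, ← hM]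
          exact sub_mem (Submodule.subset_span ⟨_, Submodule.smul_mem _ _ hz, rfl⟩)
            (Submodule.smul_mem _ _ (Submodule.subset_span ⟨_, hz, rfl⟩))
      · rw [smul_add]
        exact add_mem hy hz

end CommutatorOrder

/-! ### Differential operators act Σ-continuously -/

section SigmaContinuousAction

variable {k : Type*} {R : Type*} [Field k] [CommRing R] [Algebra k R]

variable (k R) in
/-- The `R`-module structure of `𝒟(R, k)` by left multiplication. -/
abbrev diffOpModule : Module R (diffOp k R) :=
  Module.compHom _ (diffOpOfRing k R)

attribute [local instance] diffOpModule

theorem diffOp_smul_def (r : R) (δ : diffOp k R) : r • δ = diffOpOfRing k R r * δ :=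
  rfl

/-- The index shifts by one because `commutatorOrder` starts at the zero submodule, whereas order
zero means multiplication operators. -/
theorem mem_commutatorOrder_of_mem_diffOpOfOrder {j : ℕ} {δ : diffOp k R}
    (hδ : (δ : Module.End k R) ∈ diffOpOfOrder k R j) :
    δ ∈ commutatorOrder (diffOpOfRing k R) diffOp_smul_def (j + 1) := by
  induction j generalizing δ with
  | zero =>
    refine mem_commutatorOrder_succ.2 fun r => mem_commutatorOrder_zero.2 (Subtype.ext ?_)
    obtain ⟨a, ha⟩ := hδ
    change (δ : Module.End k R) * Algebra.lmul k R r - Algebra.lmul k R r * δ = 0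
    rw [← ha, lmul_comm_sub]
  | succ j ih => exact mem_commutatorOrder_succ.2 fun r => ih (hδ r)

theorem exists_mem_commutatorOrder (δ : diffOp k R) :
    ∃ j, δ ∈ commutatorOrder (diffOpOfRing k R) diffOp_smul_def j := by
  obtain ⟨j, hj⟩ := Set.mem_iUnion.1 δ.2
  exact ⟨j + 1, mem_commutatorOrder_of_mem_diffOpOfOrder hj⟩

variable [IsLocalRing R]

theorem isSigmaContinuous_of_commutatorOrder {A : Type*} [Ring A] [Module R A] {ι : R →+* A}
    {hι : ∀ (r : R) (a : A), r • a = ι r * a} {M : Type*} [AddCommGroup M] [Module A M]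
    [Module R M] [Module k M] (hM : ∀ (r : R) (m : M), r • m = ι r • m) {j : ℕ}
    (hN : IsNoetherian R (commutatorOrder ι hι j)) {a : A} (ha : a ∈ commutatorOrder ι hι j)
    {d : M →ₗ[k] M} (hd : ∀ m, d m = a • m) : IsSigmaContinuous R d := by
  intro L hL
  have e : d '' (L : Set M) = (a • ·) '' (L : Set M) := by simp [hd]
  rw [e]
  refine ⟨span_smul_image_fg hι hM (span_range_mul_fg hN ha) hL, fun t => ⟨t + j, fun x hx => ?_⟩⟩
  rw [hd]
  exact smul_mem_pow_smul_span hM _ t ha hx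

/-- The version of `isSigmaContinuous_of_commutatorOrder` for the opposite of `A`. -/
theorem isSigmaContinuous_of_antiEquiv {A B : Type*} [Ring A] [Ring B] {mA : Module R A}
    {mB : Module R B} {ι : R →+* A} {hι : ∀ (r : R) (a : A), r • a = ι r * a} {ι' : R →+* B}
    (hι' : ∀ (r : R) (b : B), r • b = ι' r * b) (e : A ≃+ B) (he : ∀ a b, e (a * b) = e b * e a)
    (h : ∀ r, ι' r = e (ι r)) {M : Type*} [AddCommGroup M] [Module B M] [Module R M] [Module k M]
    (hM : ∀ (r : R) (m : M), r • m = ι' r • m)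
    (hN : ∀ j, IsNoetherian R (commutatorOrder ι hι j)) {j : ℕ} {a : A}
    (ha : a ∈ commutatorOrder ι hι j) {d : M →ₗ[k] M} (hd : ∀ m, d m = e a • m) :
    IsSigmaContinuous R d :=
  isSigmaContinuous_of_commutatorOrder (hι := hι') hM
    (isNoetherian_commutatorOrder_of_antiEquiv e he h hN j)
    ((antiEquiv_mem_commutatorOrder e he h).2 ha) hd

variable [IsNoetherianRing R]

/-- A `k`-linear endomorphism of `R` killing `1` and commuting with generators of the maximal ideal
is zero. -/
theorem eq_zero_of_comm_generators (hk : Function.Bijective (algebraMap k (ResidueField R)))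
    {n : ℕ} {x : Fin n → R} (hx : Ideal.span (Set.range x) = maximalIdeal R) (d : Module.End k R)
    (h1 : d 1 = 0) (hd : ∀ i y, d (x i * y) = x i * d y) : d = 0 := by
  -- Write `y = c + a` with `c ∈ k`, `a = ∑ c_i x_i`. Then `d c = 0` and `d a = ∑ x_i d c_i` gains a
  -- power of `𝔪`; Krull's intersection theorem finishes.
  have key : ∀ s : ℕ, ∀ y, d y ∈ maximalIdeal R ^ s := by
    intro s
    induction s with
    | zero => simp
    | succ s ih =>
      have hm : ∀ a ∈ maximalIdeal R, d a ∈ maximalIdeal R ^ (s + 1) := by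
        intro a ha
        rw [← hx, Ideal.mem_span_range_iff_exists_fun] at ha
        obtain ⟨c, rfl⟩ := ha
        rw [map_sum]
        refine sum_mem fun i _ => ?_
        rw [mul_comm, hd, pow_succ']
        exact Ideal.mul_mem_mul (hx ▸ Ideal.subset_span ⟨i, rfl⟩) (ih _)
      intro y
      obtain ⟨c, a, ha, rfl⟩ := exists_algebraMap_add_mem_maximalIdeal hk y
      rw [map_add, Algebra.algebraMap_eq_smul_one, map_smul, h1, smul_zero, zero_add]
      exact hm a ha
  ext y
  have h0 : d y ∈ ⨅ s : ℕ, maximalIdeal R ^ s := (Submodule.mem_iInf _).2 fun s => key s y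
  rwa [Ideal.iInf_pow_eq_bot_of_isLocalRing _ (maximalIdeal.isMaximal R).ne_top] at h0

theorem isNoetherian_diffOp_commutatorOrder
    (hk : Function.Bijective (algebraMap k (ResidueField R))) (j : ℕ) :
    IsNoetherian R (commutatorOrder (A := diffOp k R) (diffOpOfRing k R) diffOp_smul_def j) := by
  obtain ⟨n, x, hx⟩ := Submodule.fg_iff_exists_fin_generating_family.1
    (IsNoetherian.noetherian (maximalIdeal R))
  let ev : diffOp k R →ₗ[R] R :=
    { toFun := fun δ => (δ : Module.End k R) 1
      map_add' := fun _ _ => rfl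
      map_smul' := fun _ _ => rfl }
  refine isNoetherian_commutatorOrder x ev (fun δ h1 hc => Subtype.ext ?_) j
  exact eq_zero_of_comm_generators hk hx _ h1 fun i y =>
    LinearMap.congr_fun (congrArg Subtype.val (hc i)) y

theorem isSigmaContinuous_leftAct (hk : Function.Bijective (algebraMap k (ResidueField R)))
    (M : ModuleCat.{w} (diffOp k R)) (δ : diffOp k R) : IsSigmaContinuous R (leftAct M δ) := by
  obtain ⟨j, hj⟩ := exists_mem_commutatorOrder δ
  let _ : Module (diffOp k R) (leftUnderlying M) := inferInstanceAs (Module (diffOp k R) M)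
  exact isSigmaContinuous_of_commutatorOrder (fun _ _ => rfl)
    (isNoetherian_diffOp_commutatorOrder hk j) hj fun _ => rfl

theorem isSigmaContinuous_rightAct (hk : Function.Bijective (algebraMap k (ResidueField R)))
    (M : ModuleCat.{w} (diffOp k R)ᵐᵒᵖ) (δ : diffOp k R) :
    IsSigmaContinuous R (rightAct M δ) := by
  obtain ⟨j, hj⟩ := exists_mem_commutatorOrder δ
  let _ : Module (diffOp k R)ᵐᵒᵖ (rightUnderlying M) :=
    inferInstanceAs (Module (diffOp k R)ᵐᵒᵖ M)
  -- A right module is a left module over the opposite ring, and `op` is the anti-isomorphism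
  -- carrying over the Noetherian property.
  refine isSigmaContinuous_of_antiEquiv (A := diffOp k R) (B := (diffOp k R)ᵐᵒᵖ)
    (mA := diffOpModule k R) (mB := Module.compHom _ (diffOpOfRingOp k R))
    (ι := diffOpOfRing k R) (ι' := diffOpOfRingOp k R) (hι := diffOp_smul_def)
    (fun _ _ => rfl) MulOpposite.opAddEquiv (fun _ _ => rfl) (fun _ => rfl) (fun _ _ => rfl)
    (isNoetherian_diffOp_commutatorOrder hk) hj fun m => ?_
  rfl

end SigmaContinuousAction

/-! ### Dual `𝒟`-module structures and functoriality -/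

section MatlisDualModule

variable {k : Type*} {R : Type u} {E : Type (max u v)} [Field k] [CommRing R] [IsLocalRing R]
  [IsNoetherianRing R] [Algebra k R] [AddCommGroup E] [Module R E] [Module k E]
  [IsScalarTower k R E] {σ : E →ₗ[k] ResidueField R}

/-- The right `𝒟`-module structure on the Matlis dual of a left `𝒟`-module. -/
noncomputable abbrev leftDualModule (hk : Function.Bijective (algebraMap k (ResidueField R)))
    (hE : IsInjectiveHull.{u, v} R (ResidueField R) E) (hσ : IsSocleProjection σ)
    (M : ModuleCat.{w} (diffOp k R)) : Module (diffOp k R)ᵐᵒᵖ (leftUnderlying M →ₗ[R] E) where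
  smul a φ := matlisDual σ (leftAct M a.unop) φ
  one_smul φ := (matlisDual_eq_iff hk hE hσ (isSigmaContinuous_leftAct hk M _)).2 fun x =>
    congrArg (fun y => σ (φ y)) (one_smul (diffOp k R) (show M from x))
  -- Precomposition reverses products, matching `(a * b).unop = b.unop * a.unop`.
  mul_smul a b φ := (matlisDual_eq_iff hk hE hσ (isSigmaContinuous_leftAct hk M _)).2 fun x =>
    (congrArg (fun y => σ (φ y)) (mul_smul b.unop a.unop (show M from x))).trans <|
      ((socleProjection_matlisDual_apply hk hE hσ (isSigmaContinuous_leftAct hk M _) _ _).trans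
      (socleProjection_matlisDual_apply hk hE hσ (isSigmaContinuous_leftAct hk M _) _ _)).symm
  smul_zero a := (matlisDual_eq_iff hk hE hσ (isSigmaContinuous_leftAct hk M _)).2 fun _ => rfl
  smul_add a φ ψ := (matlisDual_eq_iff hk hE hσ (isSigmaContinuous_leftAct hk M _)).2 fun x => by
    refine (map_add σ _ _).trans (Eq.symm ((map_add σ _ _).trans ?_))
    exact congrArg₂ (· + ·)
      (socleProjection_matlisDual_apply hk hE hσ (isSigmaContinuous_leftAct hk M _) _ _)
      (socleProjection_matlisDual_apply hk hE hσ (isSigmaContinuous_leftAct hk M _) _ _)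
  add_smul a b φ := (matlisDual_eq_iff hk hE hσ (isSigmaContinuous_leftAct hk M _)).2 fun x => by
    refine (congrArg (fun y => σ (φ y)) (add_smul a.unop b.unop (show M from x))).trans ?_
    refine (congrArg σ (map_add φ _ _)).trans ((map_add σ _ _).trans ?_)
    refine Eq.symm ((map_add σ _ _).trans ?_)
    exact congrArg₂ (· + ·)
      (socleProjection_matlisDual_apply hk hE hσ (isSigmaContinuous_leftAct hk M _) _ _)
      (socleProjection_matlisDual_apply hk hE hσ (isSigmaContinuous_leftAct hk M _) _ _)
  zero_smul φ := (matlisDual_eq_iff hk hE hσ (isSigmaContinuous_leftAct hk M _)).2 fun x =>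
    (congrArg (fun y => σ (φ y)) (zero_smul (diffOp k R) (show M from x))).trans
      (congrArg σ (map_zero φ))

/-- The left `𝒟`-module structure on the Matlis dual of a right `𝒟`-module. -/
noncomputable abbrev rightDualModule (hk : Function.Bijective (algebraMap k (ResidueField R)))
    (hE : IsInjectiveHull.{u, v} R (ResidueField R) E) (hσ : IsSocleProjection σ)
    (M : ModuleCat.{w} (diffOp k R)ᵐᵒᵖ) : Module (diffOp k R) (rightUnderlying M →ₗ[R] E) where
  smul a φ := matlisDual σ (rightAct M a) φ
  one_smul φ := (matlisDual_eq_iff hk hE hσ (isSigmaContinuous_rightAct hk M _)).2 fun x =>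
    congrArg (fun y => σ (φ y)) (one_smul (diffOp k R)ᵐᵒᵖ (show M from x))
  mul_smul a b φ := (matlisDual_eq_iff hk hE hσ (isSigmaContinuous_rightAct hk M _)).2 fun x =>
    (congrArg (fun y => σ (φ y))
      (mul_smul (MulOpposite.op b) (MulOpposite.op a) (show M from x))).trans <|
      ((socleProjection_matlisDual_apply hk hE hσ (isSigmaContinuous_rightAct hk M _) _ _).trans
      (socleProjection_matlisDual_apply hk hE hσ (isSigmaContinuous_rightAct hk M _) _ _)).symm
  smul_zero a := (matlisDual_eq_iff hk hE hσ (isSigmaContinuous_rightAct hk M _)).2 fun _ => rfl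
  smul_add a φ ψ := (matlisDual_eq_iff hk hE hσ (isSigmaContinuous_rightAct hk M _)).2 fun x => by
    refine (map_add σ _ _).trans (Eq.symm ((map_add σ _ _).trans ?_))
    exact congrArg₂ (· + ·)
      (socleProjection_matlisDual_apply hk hE hσ (isSigmaContinuous_rightAct hk M _) _ _)
      (socleProjection_matlisDual_apply hk hE hσ (isSigmaContinuous_rightAct hk M _) _ _)
  add_smul a b φ := (matlisDual_eq_iff hk hE hσ (isSigmaContinuous_rightAct hk M _)).2 fun x => by
    refine (congrArg (fun y => σ (φ y))
      (add_smul (MulOpposite.op a) (MulOpposite.op b) (show M from x))).trans ?_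
    refine (congrArg σ (map_add φ _ _)).trans ((map_add σ _ _).trans ?_)
    refine Eq.symm ((map_add σ _ _).trans ?_)
    exact congrArg₂ (· + ·)
      (socleProjection_matlisDual_apply hk hE hσ (isSigmaContinuous_rightAct hk M _) _ _)
      (socleProjection_matlisDual_apply hk hE hσ (isSigmaContinuous_rightAct hk M _) _ _)
  zero_smul φ := (matlisDual_eq_iff hk hE hσ (isSigmaContinuous_rightAct hk M _)).2 fun x =>
    (congrArg (fun y => σ (φ y)) (zero_smul (diffOp k R)ᵐᵒᵖ (show M from x))).trans
      (congrArg σ (map_zero φ))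

theorem matlisDual_restrictScalars (hk : Function.Bijective (algebraMap k (ResidueField R)))
    (hE : IsInjectiveHull.{u, v} R (ResidueField R) E) (hσ : IsSocleProjection σ)
    {M N : Type*} [AddCommGroup M] [Module R M] [Module k M] [IsScalarTower k R M]
    [AddCommGroup N] [Module R N] [Module k N] [IsScalarTower k R N]
    (f : M →ₗ[R] N) (φ : N →ₗ[R] E) :
    matlisDual σ (f.restrictScalars k) φ = φ ∘ₗ f :=
  (matlisDual_eq_iff hk hE hσ (isSigmaContinuous_restrictScalars f)).2 fun _ => rfl

/-- The Matlis dual of an `R`-linear map intertwining `δ` and `δ'` intertwines `δ'^*` and `δ^*`. -/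
theorem matlisDual_comp (hk : Function.Bijective (algebraMap k (ResidueField R)))
    (hE : IsInjectiveHull.{u, v} R (ResidueField R) E) (hσ : IsSocleProjection σ)
    {M N : Type*} [AddCommGroup M] [Module R M] [Module k M] [IsScalarTower k R M]
    [AddCommGroup N] [Module R N] [Module k N] [IsScalarTower k R N] {f : M →ₗ[R] N}
    {δ : M →ₗ[k] M} {δ' : N →ₗ[k] N} (hδ : IsSigmaContinuous R δ) (hδ' : IsSigmaContinuous R δ')
    (h : ∀ x, f (δ x) = δ' (f x)) (φ : N →ₗ[R] E) :
    matlisDual σ δ' φ ∘ₗ f = matlisDual σ δ (φ ∘ₗ f) := by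
  refine ((matlisDual_eq_iff hk hE hσ hδ).2 fun x => ?_).symm
  rw [LinearMap.comp_apply, LinearMap.comp_apply, h,
    socleProjection_matlisDual_apply hk hE hσ hδ']

theorem leftDualModule_smul_comp (hk : Function.Bijective (algebraMap k (ResidueField R)))
    (hE : IsInjectiveHull.{u, v} R (ResidueField R) E) (hσ : IsSocleProjection σ)
    {M N : ModuleCat.{w} (diffOp k R)} (f : M ⟶ N) (δ : diffOp k R)
    (φ : leftUnderlying N →ₗ[R] E) :
    matlisDual σ (leftAct N δ) φ ∘ₗ leftHom f = matlisDual σ (leftAct M δ) (φ ∘ₗ leftHom f) :=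
  matlisDual_comp hk hE hσ (isSigmaContinuous_leftAct hk M δ) (isSigmaContinuous_leftAct hk N δ)
    (fun x => f.hom.map_smul δ (show M from x)) φ

theorem rightDualModule_smul_comp (hk : Function.Bijective (algebraMap k (ResidueField R)))
    (hE : IsInjectiveHull.{u, v} R (ResidueField R) E) (hσ : IsSocleProjection σ)
    {M N : ModuleCat.{w} (diffOp k R)ᵐᵒᵖ} (f : M ⟶ N) (δ : diffOp k R)
    (φ : rightUnderlying N →ₗ[R] E) :
    matlisDual σ (rightAct N δ) φ ∘ₗ rightHom f = matlisDual σ (rightAct M δ) (φ ∘ₗ rightHom f) :=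
  matlisDual_comp hk hE hσ (isSigmaContinuous_rightAct hk M δ)
    (isSigmaContinuous_rightAct hk N δ)
    (fun x => f.hom.map_smul (MulOpposite.op δ) (show M from x)) φ

/-- Matlis duality as a contravariant functor from left to right `𝒟`-modules. -/
noncomputable def leftDualFunctor (hk : Function.Bijective (algebraMap k (ResidueField R)))
    (hE : IsInjectiveHull.{u, v} R (ResidueField R) E) (hσ : IsSocleProjection σ) :
    (ModuleCat.{w} (diffOp k R))ᵒᵖ ⥤ ModuleCat.{max u v w} (diffOp k R)ᵐᵒᵖ :=
  letI := fun M : ModuleCat.{w} (diffOp k R) => leftDualModule hk hE hσ M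
  { obj := fun M => ModuleCat.of (diffOp k R)ᵐᵒᵖ (leftUnderlying M.unop →ₗ[R] E)
    map := fun f => ModuleCat.ofHom
      { toFun := fun φ => φ ∘ₗ leftHom f.unop
        map_add' := fun _ _ => rfl
        map_smul' := fun a φ => leftDualModule_smul_comp hk hE hσ f.unop a.unop φ }
    map_id := fun _ => rfl
    map_comp := fun _ _ => rfl }

/-- Matlis duality as a contravariant functor from right to left `𝒟`-modules. -/
noncomputable def rightDualFunctor (hk : Function.Bijective (algebraMap k (ResidueField R)))
    (hE : IsInjectiveHull.{u, v} R (ResidueField R) E) (hσ : IsSocleProjection σ) :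
    (ModuleCat.{w} (diffOp k R)ᵐᵒᵖ)ᵒᵖ ⥤ ModuleCat.{max u v w} (diffOp k R) :=
  letI := fun M : ModuleCat.{w} (diffOp k R)ᵐᵒᵖ => rightDualModule hk hE hσ M
  { obj := fun M => ModuleCat.of (diffOp k R) (rightUnderlying M.unop →ₗ[R] E)
    map := fun f => ModuleCat.ofHom
      { toFun := fun φ => φ ∘ₗ rightHom f.unop
        map_add' := fun _ _ => rfl
        map_smul' := fun a φ => rightDualModule_smul_comp hk hE hσ f.unop a φ }
    map_id := fun _ => rfl
    map_comp := fun _ _ => rfl }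

end MatlisDualModule

theorem mainTheorem7 {k : Type*} {R : Type u} {E : Type (max u v)}
    [Field k] [CommRing R] [IsLocalRing R] [IsNoetherianRing R]
    [IsAdicComplete (maximalIdeal R) R] [Algebra k R]
    (hk : Function.Bijective (algebraMap k (ResidueField R)))
    [AddCommGroup E] [Module R E] [Module k E] [IsScalarTower k R E]
    (hE : IsInjectiveHull.{u, v} R (ResidueField R) E)
    (σ : E →ₗ[k] ResidueField R) (hσ : IsSocleProjection σ) :
    -- the isomorphisms through which Matlis duals are defined
    (∀ N : ModuleCat.{w} R,
      Set.BijOn (matlisPhi (N := N) σ) Set.univ (sigmaDual k R N)) ∧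
    -- left modules: operators and morphisms are `Σ`-continuous
    (∀ (M : ModuleCat.{w} (diffOp k R)) (δ : diffOp k R), IsSigmaContinuous R (leftAct M δ)) ∧
    (∀ (M N : ModuleCat.{w} (diffOp k R)) (f : M ⟶ N),
      IsSigmaContinuous R ((leftHom f).restrictScalars k) ∧
      ∀ φ : leftUnderlying N →ₗ[R] E,
        matlisDual σ ((leftHom f).restrictScalars k) φ = φ ∘ₗ leftHom f) ∧
    -- left modules: the right structure on the Matlis dual, and functoriality
    (∃ _ : ∀ M : ModuleCat.{w} (diffOp k R),
        Module (diffOp k R)ᵐᵒᵖ (leftUnderlying M →ₗ[R] E),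
      (∀ (M : ModuleCat.{w} (diffOp k R)) (δ : diffOp k R) (φ : leftUnderlying M →ₗ[R] E),
        MulOpposite.op δ • φ = matlisDual σ (leftAct M δ) φ) ∧
      (∀ (M : ModuleCat.{w} (diffOp k R)) (r : R) (φ : leftUnderlying M →ₗ[R] E),
        MulOpposite.op (diffOpOfRing k R r) • φ = r • φ) ∧
      (∀ (M N : ModuleCat.{w} (diffOp k R)) (f : M ⟶ N) (δ : diffOp k R)
        (φ : leftUnderlying N →ₗ[R] E),
        (MulOpposite.op δ • φ) ∘ₗ leftHom f = MulOpposite.op δ • (φ ∘ₗ leftHom f)) ∧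
      ∃ (F : (ModuleCat.{w} (diffOp k R))ᵒᵖ ⥤ ModuleCat.{max u v w} (diffOp k R)ᵐᵒᵖ)
        (e : ∀ M : ModuleCat.{w} (diffOp k R),
          F.obj (Opposite.op M) ≃ₗ[(diffOp k R)ᵐᵒᵖ] (leftUnderlying M →ₗ[R] E)),
        ∀ (M N : ModuleCat.{w} (diffOp k R)) (f : M ⟶ N) (x : F.obj (Opposite.op N)),
          e M ((F.map f.op).hom x) = e N x ∘ₗ leftHom f) ∧
    -- right modules: operators and morphisms are `Σ`-continuous
    (∀ (M : ModuleCat.{w} (diffOp k R)ᵐᵒᵖ) (δ : diffOp k R), IsSigmaContinuous R (rightAct M δ)) ∧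
    (∀ (M N : ModuleCat.{w} (diffOp k R)ᵐᵒᵖ) (f : M ⟶ N),
      IsSigmaContinuous R ((rightHom f).restrictScalars k) ∧
      ∀ φ : rightUnderlying N →ₗ[R] E,
        matlisDual σ ((rightHom f).restrictScalars k) φ = φ ∘ₗ rightHom f) ∧
    -- right modules: the left structure on the Matlis dual, and functoriality
    (∃ _ : ∀ M : ModuleCat.{w} (diffOp k R)ᵐᵒᵖ,
        Module (diffOp k R) (rightUnderlying M →ₗ[R] E),
      (∀ (M : ModuleCat.{w} (diffOp k R)ᵐᵒᵖ) (δ : diffOp k R) (φ : rightUnderlying M →ₗ[R] E),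
        δ • φ = matlisDual σ (rightAct M δ) φ) ∧
      (∀ (M : ModuleCat.{w} (diffOp k R)ᵐᵒᵖ) (r : R) (φ : rightUnderlying M →ₗ[R] E),
        diffOpOfRing k R r • φ = r • φ) ∧
      (∀ (M N : ModuleCat.{w} (diffOp k R)ᵐᵒᵖ) (f : M ⟶ N) (δ : diffOp k R)
        (φ : rightUnderlying N →ₗ[R] E),
        (δ • φ) ∘ₗ rightHom f = δ • (φ ∘ₗ rightHom f)) ∧
      ∃ (F : (ModuleCat.{w} (diffOp k R)ᵐᵒᵖ)ᵒᵖ ⥤ ModuleCat.{max u v w} (diffOp k R))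
        (e : ∀ M : ModuleCat.{w} (diffOp k R)ᵐᵒᵖ,
          F.obj (Opposite.op M) ≃ₗ[diffOp k R] (rightUnderlying M →ₗ[R] E)),
        ∀ (M N : ModuleCat.{w} (diffOp k R)ᵐᵒᵖ) (f : M ⟶ N) (x : F.obj (Opposite.op N)),
          e M ((F.map f.op).hom x) = e N x ∘ₗ rightHom f) := by
  refine ⟨fun N => matlisPhi_bijOn hk hE hσ N, isSigmaContinuous_leftAct hk,
    fun M N f => ⟨isSigmaContinuous_restrictScalars _, matlisDual_restrictScalars hk hE hσ _⟩,
    ⟨leftDualModule hk hE hσ, fun _ _ _ => rfl, fun M r φ => ?_,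
      fun _ _ => leftDualModule_smul_comp hk hE hσ, leftDualFunctor hk hE hσ,
      fun M => @LinearEquiv.refl _ _ _ _ (leftDualModule hk hE hσ M), fun _ _ _ _ => rfl⟩,
    isSigmaContinuous_rightAct hk,
    fun M N f => ⟨isSigmaContinuous_restrictScalars _, matlisDual_restrictScalars hk hE hσ _⟩,
    ⟨rightDualModule hk hE hσ, fun _ _ _ => rfl, fun M r φ => ?_,
      fun _ _ => rightDualModule_smul_comp hk hE hσ, rightDualFunctor hk hE hσ,
      fun M => @LinearEquiv.refl _ _ _ _ (rightDualModule hk hE hσ M), fun _ _ _ _ => rfl⟩⟩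
  -- For multiplication by `r`, the identity to check is `σ (φ (r • x)) = σ (r • φ x)`, which is
  -- linearity of `φ`.
  · exact (matlisDual_eq_iff hk hE hσ (isSigmaContinuous_leftAct hk M _)).2 fun x =>
      congrArg σ (φ.map_smul r x)
  · exact (matlisDual_eq_iff hk hE hσ (isSigmaContinuous_rightAct hk M _)).2 fun x =>
      congrArg σ (φ.map_smul r x)
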